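/- Let $\mathcal P=(\mathbf x,\mathbf r)$ be a group presentation, where $\mathbf r$ is a subset of the free group $F$ on $\mathbf x$. Let $Y\cup Y^{-1}$ be the set of formal symbols $({}^{u}r)^{\varepsilon}$ with $u\in F$, $r\in\mathbf r$, $\varepsilon=\pm1$; put $\theta(({}^{u}r)^{\varepsilon})=ur^{\varepsilon}u^{-1}$, ${}^{w}(({}^{u}r)^{\varepsilon})=({}^{wu}r)^{\varepsilon}$ for $w\in F$, and $(({}^{u}r)^{\varepsilon})^{-1}=({}^{u}r)^{-\varepsilon}$. A $Y$-sequence is a finite sequence $(a_1,\dots,a_n)$ of elements of $Y\cup Y^{-1}$; it is an identity $Y$-sequence if $\theta(a_1)\cdots\theta(a_n)=1$ in $F$. Peiffer equivalence is the equivalence relation on $Y$-sequences generated by replacing an adjacent pair $(a,b)$ by $({}^{\theta(a)}b,a)$ or by $(b,{}^{\theta(b)^{-1}}a)$, and by deleting an adjacent pair $(a,a^{-1})$. The presentation $\mathcal P$ is called aspherical if every identity $Y$-sequence is Peiffer equivalent to the empty sequence (by a classical theorem this means that $\pi_2$ of the geometric realisation of $\mathcal P$ vanishes). Let $\Upsilon$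 be the monoid generated by $Y\cup Y^{-1}$ subject to the relations $ab={}^{\theta(a)}b\,a$ ($a,b\in Y\cup Y^{-1}$), let $\sigma$ be the canonical map from words over $Y\cup Y^{-1}$ to $\Upsilon$, let $\mathcal G(\Upsilon)$ be the universal enveloping group of $\Upsilon$ (the group with the same generators and relations), and let $\mu:\Upsilon\to\mathcal G(\Upsilon)$ be the canonical homomorphism. The map $\theta$ induces a homomorphism $\tilde\theta:\mathcal G(\Upsilon)\to F$, and $F$ acts on $\mathcal G(\Upsilon)$ by ${}^{w}\mu\sigma(a)=\mu\sigma({}^{w}a)$. Put $\tilde\Pi=\operatorname{Ker}\tilde\theta$, an abelian group which is stable under the action of $F$. Fix $r_0\in\mathbf r$, let $\mathcal P_1=(\mathbf x,\mathbf r\setminus\{r_0\})$, and denote by a subscript $1$ the objects formed in the same way from $\mathcal P_1$. Let $\hat f:\mathcal G(\Upsilon_1)\to\mathcal G(\Upsilon)$ be the homomorphism induced by the homomorphism $f:\Upsilon_1\to\Upsilon$, $\sigma_1(a)\mapsto\sigma(a)$. Let $\hat{\mathfrak A}_1$ be the subgroup of $\mathcal G(\Upsilon)$ generated by all $\mu\sigma(bb^{-1})$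 with $b\in Y_1\cup Y_1^{-1}$. Let $N_0$ be the normal closure of $r_0$ in $F$, and let $[\tilde\Pi_1,N_0]$ be the subgroup of $\tilde\Pi_1$ generated by all elements $d^{-1}\cdot{}^{n}d$ with $d\in\tilde\Pi_1$, $n\in N_0$. **Proposition.** If $\mathcal P$ is aspherical, then $\hat f$ maps $\tilde\Pi_1$ onto $\hat{\mathfrak A}_1$, that is, $\hat f(\tilde\Pi_1)=\hat{\mathfrak A}_1$, and $\hat f$ induces an epimorphism $\tilde\Pi_1/[\tilde\Pi_1,N_0]\to\hat{\mathfrak A}_1$, $d\,[\tilde\Pi_1,N_0]\mapsto\hat f(d)$. -/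

import Mathlib

/-! ### Universal enveloping groups of presented monoids -/

section EnvelopingGroup

variable {A : Type*}

/-- The universal enveloping group `𝒢(S)` of the monoid `S = ⟨A ∣ rels⟩`: the group with the same
generators, and with one relator `u v⁻¹` for every defining relation `u = v` of `S`. -/
def EnvelopingGroup (rels : FreeMonoid A → FreeMonoid A → Prop) : Type _ :=
  PresentedGroup {w : FreeGroup A | ∃ u v : FreeMonoid A, rels u v ∧
    w = FreeMonoid.lift FreeGroup.of u * (FreeMonoid.lift FreeGroup.of v)⁻¹}

namespace EnvelopingGroup

variable {rels : FreeMonoid A → FreeMonoid A → Prop}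

instance : Group (EnvelopingGroup rels) := inferInstanceAs (Group (PresentedGroup _))

variable (rels) in
/-- The canonical map from words to the enveloping group. -/
def wordMap : FreeMonoid A →* EnvelopingGroup rels :=
  (PresentedGroup.mk _).comp (FreeMonoid.lift FreeGroup.of)

variable (rels) in
/-- The canonical homomorphism `μ : S → 𝒢(S)`. -/
def mu : PresentedMonoid rels →* EnvelopingGroup rels :=
  PresentedMonoid.lift (fun a => wordMap rels (FreeMonoid.of a)) (by
    intro u v h
    have key : ∀ w : FreeMonoid A,
        FreeMonoid.lift (fun a => wordMap rels (FreeMonoid.of a)) w = wordMap rels w := by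
      intro w
      exact DFunLike.congr_fun (FreeMonoid.lift_restrict (wordMap rels)) w
    rw [key, key]
    exact PresentedGroup.mk_eq_mk_of_mul_inv_mem ⟨u, v, h, rfl⟩)

/-- The universal property of `μ : S → 𝒢(S)`: a monoid homomorphism `g : S → G` to a group induces
a group homomorphism `ĝ : 𝒢(S) → G` with `ĝ ∘ μ = g`. -/
def lift {G : Type*} [Group G] (g : PresentedMonoid rels →* G) : EnvelopingGroup rels →* G :=
  PresentedGroup.toGroup (f := fun a => g (PresentedMonoid.of rels a)) (by
    rintro w ⟨u, v, h, rfl⟩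
    have key : ∀ w : FreeMonoid A,
        FreeGroup.lift (fun a => g (PresentedMonoid.of rels a))
          (FreeMonoid.lift FreeGroup.of w) = g (PresentedMonoid.mk rels w) := by
      intro w
      have h2 : (FreeGroup.lift (fun a => g (PresentedMonoid.of rels a)) :
            FreeGroup A →* G).comp (FreeMonoid.lift FreeGroup.of)
          = g.comp (PresentedMonoid.mk rels) := by
        ext a; simp [PresentedMonoid.of]
      exact DFunLike.congr_fun h2 w
    rw [map_mul, map_inv, key, key, PresentedMonoid.mk_eq_mk_of_rel h, mul_inv_cancel])

theorem lift_mu {G : Type*} [Group G] (g : PresentedMonoid rels →* G) (s : PresentedMonoid rels) :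
    lift g (mu rels s) = g s := by
  have : (lift g).comp (mu rels) = g := by
    ext a
    simp only [MonoidHom.comp_apply]
    exact FreeGroup.lift_apply_of
  exact DFunLike.congr_fun this s

theorem hom_ext {G : Type*} [Group G] {g h : EnvelopingGroup rels →* G}
    (H : ∀ a, g (mu rels (PresentedMonoid.of rels a)) = h (mu rels (PresentedMonoid.of rels a))) :
    g = h :=
  PresentedGroup.ext H

end EnvelopingGroup

end EnvelopingGroup

/-! ### `Y`-sequences and asphericity of a group presentation `(X, R)`, with `R ⊆ FreeGroup X` -/

namespace GroupPresentation

variable {X : Type*}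

/-- An element `(ᵘr)^ε` of `Y ∪ Y⁻¹`: a formal symbol with `u` in the free group on `X`,
`r ∈ R` and `ε = ±1`. -/
structure Letter (R : Set (FreeGroup X)) where
  /-- the conjugator `u` -/
  conj : FreeGroup X
  /-- the relator `r` -/
  rel : R
  /-- the exponent `ε` -/
  sign : ℤˣ

namespace Letter

variable {R : Set (FreeGroup X)}

/-- The formal inverse `(ᵘr)^(-ε)` of `(ᵘr)^ε`. -/
def inv (a : Letter R) : Letter R := ⟨a.conj, a.rel, -a.sign⟩

/-- The action `ʷ((ᵘr)^ε) = (ʷᵘr)^ε` of the free group on letters. -/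
instance : MulAction (FreeGroup X) (Letter R) where
  smul w a := ⟨w * a.conj, a.rel, a.sign⟩
  one_smul a := by
    change (⟨1 * a.conj, a.rel, a.sign⟩ : Letter R) = a
    rw [one_mul]
  mul_smul v w a := by
    change (⟨v * w * a.conj, a.rel, a.sign⟩ : Letter R) = ⟨v * (w * a.conj), a.rel, a.sign⟩
    rw [mul_assoc]

/-- `θ((ᵘr)^ε) = u r^ε u⁻¹`. -/
def theta (a : Letter R) : FreeGroup X :=
  a.conj * (a.rel : FreeGroup X) ^ (a.sign : ℤ) * a.conj⁻¹

theorem theta_smul (w : FreeGroup X) (a : Letter R) : (w • a).theta = w * a.theta * w⁻¹ := by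
  change w * a.conj * (a.rel : FreeGroup X) ^ (a.sign : ℤ) * (w * a.conj)⁻¹ = _
  simp only [theta, mul_inv_rev, mul_assoc]

theorem theta_inv (a : Letter R) : a.inv.theta = a.theta⁻¹ := by
  simp [theta, inv, mul_assoc]

/-- The inclusion of letters coming from an inclusion of sets of relators. -/
def incl {R₁ R : Set (FreeGroup X)} (h : R₁ ⊆ R) (a : Letter R₁) : Letter R :=
  ⟨a.conj, ⟨a.rel, h a.rel.2⟩, a.sign⟩

end Letter

/-- The elementary Peiffer operations on `Y`-sequences: the two forms of the Peiffer exchange, and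
the Peiffer deletion. -/
inductive PeifferStep {R : Set (FreeGroup X)} : List (Letter R) → List (Letter R) → Prop
  | exchange_left (s t : List (Letter R)) (a b : Letter R) :
      PeifferStep (s ++ [a, b] ++ t) (s ++ [a.theta • b, a] ++ t)
  | exchange_right (s t : List (Letter R)) (a b : Letter R) :
      PeifferStep (s ++ [a, b] ++ t) (s ++ [b, b.theta⁻¹ • a] ++ t)
  | deletion (s t : List (Letter R)) (a : Letter R) :
      PeifferStep (s ++ [a, a.inv] ++ t) (s ++ t)

/-- Peiffer equivalence: the equivalence relation generated by Peiffer exchanges, deletions and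
insertions. -/
def PeifferEquiv {R : Set (FreeGroup X)} : List (Letter R) → List (Letter R) → Prop :=
  Relation.EqvGen PeifferStep

/-- An identity `Y`-sequence: a `Y`-sequence `(a₁, …, aₙ)` with `θ(a₁) ⋯ θ(aₙ) = 1`. -/
def IsIdentitySequence {R : Set (FreeGroup X)} (d : List (Letter R)) : Prop :=
  (d.map Letter.theta).prod = 1

/-- The presentation `(X, R)` is aspherical: every identity `Y`-sequence is Peiffer equivalent to
the empty sequence. -/
def Aspherical (R : Set (FreeGroup X)) : Prop :=
  ∀ d : List (Letter R), IsIdentitySequence d → PeifferEquiv d []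

/-! ### The monoid `Υ` and the group `𝒢(Υ)` -/

/-- The defining relations `a b = ᶿ⁽ᵃ⁾b a` of `Υ`, for `a, b ∈ Y ∪ Y⁻¹`. -/
inductive PeifferRel (R : Set (FreeGroup X)) :
    FreeMonoid (Letter R) → FreeMonoid (Letter R) → Prop
  | mk (a b : Letter R) :
      PeifferRel R (FreeMonoid.of a * FreeMonoid.of b)
        (FreeMonoid.of (a.theta • b) * FreeMonoid.of a)

/-- The monoid `Υ` with generators `Y ∪ Y⁻¹` and relations `a b = ᶿ⁽ᵃ⁾b a`. -/
abbrev Upsilon (R : Set (FreeGroup X)) : Type _ := PresentedMonoid (PeifferRel R)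

/-- The canonical image `σ(a)` of a letter in `Υ`. -/
abbrev sigma {R : Set (FreeGroup X)} (a : Letter R) : Upsilon R :=
  PresentedMonoid.of (PeifferRel R) a

/-- The universal enveloping group `𝒢(Υ)`. -/
abbrev GUpsilon (R : Set (FreeGroup X)) : Type _ := EnvelopingGroup (PeifferRel R)

/-- The canonical homomorphism `μ : Υ → 𝒢(Υ)`. -/
abbrev mu (R : Set (FreeGroup X)) : Upsilon R →* GUpsilon R := EnvelopingGroup.mu (PeifferRel R)

theorem sigma_mul_sigma {R : Set (FreeGroup X)} (a b : Letter R) :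
    sigma a * sigma b = sigma (a.theta • b) * sigma a :=
  PresentedMonoid.mk_eq_mk_of_rel (PeifferRel.mk a b)

/-- The homomorphism out of `Υ` given by a map on letters compatible with the relations. -/
def Upsilon.lift {R : Set (FreeGroup X)} {M : Type*} [Monoid M] (φ : Letter R → M)
    (h : ∀ a b, φ a * φ b = φ (a.theta • b) * φ a) : Upsilon R →* M :=
  PresentedMonoid.lift φ (by
    rintro _ _ ⟨a, b⟩
    simpa using h a b)

/-- The homomorphism `θ̃ : 𝒢(Υ) → F`, `μσ((ᵘr)^ε) ↦ u r^ε u⁻¹`. -/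
def thetaTilde (R : Set (FreeGroup X)) : GUpsilon R →* FreeGroup X :=
  EnvelopingGroup.lift (Upsilon.lift Letter.theta (by
    intro a b
    rw [Letter.theta_smul, inv_mul_cancel_right]))

theorem thetaTilde_mu_sigma {R : Set (FreeGroup X)} (a : Letter R) :
    thetaTilde R (mu R (sigma a)) = a.theta :=
  EnvelopingGroup.lift_mu _ _

/-- The action of a free group element `w` on `𝒢(Υ)`, `μσ((ᵘr)^ε) ↦ μσ((ʷᵘr)^ε)`. -/
def actHom (R : Set (FreeGroup X)) (w : FreeGroup X) : GUpsilon R →* GUpsilon R :=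
  EnvelopingGroup.lift (Upsilon.lift (fun a => mu R (sigma (w • a))) (by
    intro a b
    rw [← map_mul, ← map_mul, sigma_mul_sigma, Letter.theta_smul, smul_smul, smul_smul,
      inv_mul_cancel_right]))

theorem actHom_mu_sigma {R : Set (FreeGroup X)} (w : FreeGroup X) (a : Letter R) :
    actHom R w (mu R (sigma a)) = mu R (sigma (w • a)) :=
  EnvelopingGroup.lift_mu _ _

/-- The action of the free group `F` on `𝒢(Υ)` by group automorphisms. -/
instance (R : Set (FreeGroup X)) : MulDistribMulAction (FreeGroup X) (GUpsilon R) where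
  smul w g := actHom R w g
  one_smul g := by
    have h : actHom R 1 = MonoidHom.id _ := by
      apply EnvelopingGroup.hom_ext
      intro a
      exact (actHom_mu_sigma 1 a).trans (by rw [one_smul]; rfl)
    exact DFunLike.congr_fun h g
  mul_smul v w g := by
    have h : actHom R (v * w) = (actHom R v).comp (actHom R w) := by
      apply EnvelopingGroup.hom_ext
      intro a
      refine (actHom_mu_sigma (v * w) a).trans ?_
      refine Eq.trans ?_ (congrArg (actHom R v) (actHom_mu_sigma w a).symm)
      rw [mul_smul]
      exact (actHom_mu_sigma v (w • a)).symm
    exact DFunLike.congr_fun h g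
  smul_one w := map_one (actHom R w)
  smul_mul w := map_mul (actHom R w)

theorem smul_mu_sigma {R : Set (FreeGroup X)} (w : FreeGroup X) (a : Letter R) :
    w • mu R (sigma a) = mu R (sigma (w • a)) :=
  actHom_mu_sigma w a

theorem thetaTilde_smul {R : Set (FreeGroup X)} (w : FreeGroup X) (g : GUpsilon R) :
    thetaTilde R (w • g) = w * thetaTilde R g * w⁻¹ := by
  have h : (thetaTilde R).comp (actHom R w)
      = ((MulAut.conj w).toMonoidHom).comp (thetaTilde R) := by
    apply EnvelopingGroup.hom_ext
    intro a
    refine (congrArg (thetaTilde R) (actHom_mu_sigma w a)).trans ?_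
    refine (thetaTilde_mu_sigma _).trans ?_
    rw [Letter.theta_smul]
    exact congrArg (fun t => w * t * w⁻¹) (thetaTilde_mu_sigma a).symm
  exact DFunLike.congr_fun h g

/-- The Peiffer identity in the crossed module `(𝒢(Υ), F, θ̃)`. -/
theorem peiffer_identity {R : Set (FreeGroup X)} (g h : GUpsilon R) :
    g * h * g⁻¹ = thetaTilde R g • h := by
  have H : (MulAut.conj : GUpsilon R →* MulAut (GUpsilon R))
      = (MulDistribMulAction.toMulAut (FreeGroup X) (GUpsilon R)).comp (thetaTilde R) := by
    apply EnvelopingGroup.hom_ext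
    intro a
    apply MulEquiv.toMonoidHom_injective
    apply EnvelopingGroup.hom_ext
    intro b
    change mu R (sigma a) * mu R (sigma b) * (mu R (sigma a))⁻¹
      = thetaTilde R (mu R (sigma a)) • mu R (sigma b)
    rw [thetaTilde_mu_sigma, smul_mu_sigma, ← map_mul, sigma_mul_sigma, map_mul,
      mul_inv_cancel_right]
  exact DFunLike.congr_fun (DFunLike.congr_fun H g) h

/-! ### The generalized module of identities and the displacement subgroup -/

/-- The generalized module of identities `Π̃ = Ker θ̃`. -/
def genIdentities (R : Set (FreeGroup X)) : Subgroup (GUpsilon R) := (thetaTilde R).ker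

theorem genIdentities_central {R : Set (FreeGroup X)} {d : GUpsilon R}
    (hd : d ∈ genIdentities R) (g : GUpsilon R) : d * g = g * d := by
  have h := peiffer_identity d g
  rw [show thetaTilde R d = 1 from hd, one_smul] at h
  exact mul_inv_eq_iff_eq_mul.mp h

/-- `Π̃` is abelian. -/
instance (R : Set (FreeGroup X)) : CommGroup (genIdentities R) where
  __ := (inferInstance : Group (genIdentities R))
  mul_comm d e := Subtype.ext (genIdentities_central d.2 (e : GUpsilon R))

/-- The action of the free group `F` on `Π̃`, the restriction of its action on `𝒢(Υ)`. -/
instance (R : Set (FreeGroup X)) : MulDistribMulAction (FreeGroup X) (genIdentities R) where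
  smul w d := ⟨w • (d : GUpsilon R), by
    change thetaTilde R (w • (d : GUpsilon R)) = 1
    rw [thetaTilde_smul, show thetaTilde R (d : GUpsilon R) = 1 from d.2, mul_one,
      mul_inv_cancel]⟩
  one_smul d := Subtype.ext (one_smul _ (d : GUpsilon R))
  mul_smul v w d := Subtype.ext (mul_smul v w (d : GUpsilon R))
  smul_one w := Subtype.ext (map_one (actHom R w))
  smul_mul w d e := Subtype.ext (smul_mul' w (d : GUpsilon R) (e : GUpsilon R))

/-- The displacement subgroup `[Π̃, N]`: the subgroup of `Π̃` generated by the elements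
`d⁻¹ · ⁿd` with `d ∈ Π̃` and `n ∈ N`. -/
def displacement (R : Set (FreeGroup X)) (N : Subgroup (FreeGroup X)) :
    Subgroup (genIdentities R) :=
  Subgroup.closure {m | ∃ d : genIdentities R, ∃ n ∈ N, m = d⁻¹ * n • d}

/-! ### Subpresentations -/

section Sub

variable {R₁ R : Set (FreeGroup X)}

/-- The homomorphism `f : Υ₁ → Υ`, `σ₁(a) ↦ σ(a)`. -/
def fHom (h : R₁ ⊆ R) : Upsilon R₁ →* Upsilon R :=
  Upsilon.lift (fun a => sigma (a.incl h)) (fun a b => sigma_mul_sigma (a.incl h) (b.incl h))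

/-- The homomorphism `f̂ : 𝒢(Υ₁) → 𝒢(Υ)` induced by `f`; it satisfies `f̂ ∘ μ₁ = μ ∘ f`. -/
def fHat (h : R₁ ⊆ R) : GUpsilon R₁ →* GUpsilon R :=
  EnvelopingGroup.lift ((mu R).comp (fHom h))

/-- The subgroup `𝔄̂₁` of `𝒢(Υ)` generated by the elements `μσ(b b⁻¹)` with `b ∈ Y₁ ∪ Y₁⁻¹`. -/
def AHat (h : R₁ ⊆ R) : Subgroup (GUpsilon R) :=
  Subgroup.closure
    (Set.range fun b : Letter R₁ => mu R (sigma (b.incl h) * sigma (b.incl h).inv))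

end Sub

end GroupPresentation

namespace GroupPresentation

variable {X : Type*} {R₁ R : Set (FreeGroup X)}

/-! Modulo the central elements `μσ(a a⁻¹)`, words in 𝒢(Υ) become `Y`-sequences up to Peiffer
equivalence, so asphericity forces Π̃ to be generated by these elements
(`Aspherical.genIdentities_eq`). The homomorphism `pairHom`, defined on all of 𝒢(Υ), fixes each of
them and hence all of Π̃. For `d` in Π̃₁ this gives `f̂(d) = pairHom(f̂(d))`, and `pairHom ∘ f̂`
sends each generator of 𝒢(Υ₁) into 𝔄̂₁; the generators of 𝔄̂₁ visibly lift. The displacement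
subgroup dies without asphericity: N₀ lies in the image of θ̃, which acts trivially on Π̃ by the
Peiffer identity and centrality. -/

theorem thetaTilde_smul_of_mem {d : GUpsilon R} (hd : d ∈ genIdentities R) (g : GUpsilon R) :
    thetaTilde R g • d = d := by
  rw [← peiffer_identity, ← genIdentities_central hd, mul_inv_cancel_right]

/-! ### The elements `μσ(a a⁻¹)` and the retraction onto the subgroup they generate -/

namespace Letter

theorem inv_inv (a : Letter R) : a.inv.inv = a := by
  cases a; simp [inv]

/-- The element `μσ(a a⁻¹)` of `Π̃`. -/
def pairIdentity (a : Letter R) : genIdentities R :=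
  ⟨mu R (sigma a * sigma a.inv), by
    change thetaTilde R _ = 1
    rw [map_mul, map_mul, thetaTilde_mu_sigma, thetaTilde_mu_sigma, theta_inv, mul_inv_cancel]⟩

theorem coe_pairIdentity (a : Letter R) :
    (a.pairIdentity : GUpsilon R) = mu R (sigma a) * mu R (sigma a.inv) :=
  map_mul _ _ _

/-- The formal inverse is not the group inverse in 𝒢(Υ), so this needs centrality: `a a⁻¹` commutes
with `a`, and one `a` cancels on the left. -/
theorem pairIdentity_inv (a : Letter R) : a.inv.pairIdentity = a.pairIdentity := by
  apply Subtype.ext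
  have h := genIdentities_central a.inv.pairIdentity.2 (mu R (sigma a))
  rw [coe_pairIdentity, inv_inv, ← mul_assoc] at h
  rw [coe_pairIdentity, coe_pairIdentity, inv_inv]
  have h2 := genIdentities_central a.pairIdentity.2 (mu R (sigma a))
  rw [coe_pairIdentity, mul_assoc] at h2
  exact mul_left_cancel h2

/-- The element `θ(a)` lies in the image of θ̃, so it fixes Π̃ pointwise. This makes `pairHom`
respect the Peiffer relations. -/
theorem pairIdentity_theta_smul (a b : Letter R) :
    (a.theta • b).pairIdentity = b.pairIdentity := by
  apply Subtype.ext
  have h := thetaTilde_smul_of_mem b.pairIdentity.2 (mu R (sigma a))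
  rw [thetaTilde_mu_sigma, coe_pairIdentity, smul_mul', smul_mu_sigma, smul_mu_sigma] at h
  rw [coe_pairIdentity, coe_pairIdentity]
  exact h

end Letter

/-- The homomorphism `𝒢(Υ) → Π̃` sending a positive generator `a` to `a a⁻¹` and the negative
generators to `1`. -/
def pairHom (R : Set (FreeGroup X)) : GUpsilon R →* genIdentities R :=
  EnvelopingGroup.lift (Upsilon.lift (fun a => if a.sign = 1 then a.pairIdentity else 1) (by
    intro a b
    rw [Letter.pairIdentity_theta_smul]
    -- `θ(a) • b` has the sign of `b` by definition, so only commutativity of Π̃ is left.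
    exact mul_comm _ _))

theorem pairHom_mu_sigma (a : Letter R) :
    pairHom R (mu R (sigma a)) = if a.sign = 1 then a.pairIdentity else 1 :=
  EnvelopingGroup.lift_mu _ _

/-- Exactly one of `a`, `a⁻¹` is positive, so exactly one factor survives; by `pairIdentity_inv` it
does not matter which. -/
theorem pairHom_pairIdentity (a : Letter R) :
    pairHom R (a.pairIdentity : GUpsilon R) = a.pairIdentity := by
  rw [Letter.coe_pairIdentity, map_mul, pairHom_mu_sigma, pairHom_mu_sigma,
    Letter.pairIdentity_inv]
  rcases Int.units_eq_one_or a.sign with h | h <;> simp [Letter.inv, h]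

/-- The subgroup of `𝒢(Υ)` generated by the elements `μσ(a a⁻¹)`. -/
def pairSubgroup (R : Set (FreeGroup X)) : Subgroup (GUpsilon R) :=
  Subgroup.closure (Set.range fun a : Letter R => (a.pairIdentity : GUpsilon R))

theorem pairIdentity_mem_pairSubgroup (a : Letter R) :
    (a.pairIdentity : GUpsilon R) ∈ pairSubgroup R :=
  Subgroup.subset_closure ⟨a, rfl⟩

theorem pairSubgroup_le_genIdentities : pairSubgroup R ≤ genIdentities R := by
  rw [pairSubgroup, Subgroup.closure_le]
  rintro _ ⟨a, rfl⟩
  exact a.pairIdentity.2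

theorem pairHom_of_mem_pairSubgroup {g : GUpsilon R} (hg : g ∈ pairSubgroup R) :
    (pairHom R g : GUpsilon R) = g := by
  refine (Subgroup.closure_le (((genIdentities R).subtype.comp (pairHom R)).eqLocus
    (MonoidHom.id _))).2 ?_ hg
  rintro _ ⟨a, rfl⟩
  exact congrArg Subtype.val (pairHom_pairIdentity a)

instance : (pairSubgroup R).Normal where
  conj_mem d hd g := by
    rw [← genIdentities_central (pairSubgroup_le_genIdentities hd) g, mul_inv_cancel_right]
    exact hd

/-! ### Peiffer equivalence and the quotient of 𝒢(Υ) by the pair subgroup -/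

/-- The value in `𝒢(Υ)` of a `Y`-sequence. -/
def seqValue (l : List (Letter R)) : GUpsilon R := (l.map fun a => mu R (sigma a)).prod

theorem seqValue_append (l m : List (Letter R)) :
    seqValue (l ++ m) = seqValue l * seqValue m := by
  simp [seqValue]

theorem seqValue_pair (a b : Letter R) :
    seqValue [a, b] = mu R (sigma a) * mu R (sigma b) := by
  simp [seqValue]

theorem thetaTilde_seqValue (l : List (Letter R)) :
    thetaTilde R (seqValue l) = (l.map Letter.theta).prod := by
  rw [seqValue, map_list_prod, List.map_map]
  congr 2
  funext a
  exact thetaTilde_mu_sigma a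

/-- Exchanges already preserve the value in 𝒢(Υ); only deletion needs the quotient. -/
theorem mk_seqValue_eq_of_peifferStep {l m : List (Letter R)} (h : PeifferStep l m) :
    (seqValue l : GUpsilon R ⧸ pairSubgroup R) = seqValue m := by
  cases h with
  | exchange_left s t a b =>
    have h : seqValue [a, b] = seqValue [a.theta • b, a] := by
      rw [seqValue_pair, seqValue_pair, ← map_mul, sigma_mul_sigma, map_mul]
    simp only [seqValue_append, h]
  | exchange_right s t a b =>
    have h : seqValue [a, b] = seqValue [b, b.theta⁻¹ • a] := by
      -- This is the defining relation for the pair `b`, `θ(b)⁻¹ • a`, read backwards.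
      rw [seqValue_pair, seqValue_pair, ← map_mul, ← map_mul, sigma_mul_sigma b, smul_inv_smul]
    simp only [seqValue_append, h]
  | deletion s t a =>
    have h : ((a.pairIdentity : GUpsilon R) : GUpsilon R ⧸ pairSubgroup R) = 1 :=
      (QuotientGroup.eq_one_iff _).2 (pairIdentity_mem_pairSubgroup a)
    rw [seqValue_append, seqValue_append, seqValue_append, seqValue_pair,
      ← Letter.coe_pairIdentity, QuotientGroup.mk_mul, QuotientGroup.mk_mul, h, mul_one,
      QuotientGroup.mk_mul]

theorem mk_seqValue_eq_of_peifferEquiv {l m : List (Letter R)} (h : PeifferEquiv l m) :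
    (seqValue l : GUpsilon R ⧸ pairSubgroup R) = seqValue m := by
  induction h with
  | rel _ _ h => exact mk_seqValue_eq_of_peifferStep h
  | refl => rfl
  | symm _ _ _ ih => exact ih.symm
  | trans _ _ _ _ _ ih₁ ih₂ => exact ih₁.trans ih₂

/-- In the quotient the group inverse of a generator is its formal inverse, so positive words
suffice. -/
theorem exists_mk_seqValue (g : GUpsilon R) :
    ∃ l : List (Letter R), (g : GUpsilon R ⧸ pairSubgroup R) = seqValue l := by
  obtain ⟨w, rfl⟩ := PresentedGroup.mk_surjective _ g
  induction w using FreeGroup.induction_on with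
  | C1 => exact ⟨[], by simp [seqValue]; rfl⟩
  | of a => exact ⟨[a], by simp [seqValue]; rfl⟩
  | inv_of a _ =>
    refine ⟨[a.inv], ?_⟩
    have h : ((a.pairIdentity : GUpsilon R) : GUpsilon R ⧸ pairSubgroup R) = 1 :=
      (QuotientGroup.eq_one_iff _).2 (pairIdentity_mem_pairSubgroup a)
    rw [Letter.coe_pairIdentity, QuotientGroup.mk_mul] at h
    rw [map_inv]
    simp only [seqValue, List.map_cons, List.map_nil, List.prod_singleton]
    exact inv_eq_of_mul_eq_one_right h
  | mul v w hv hw =>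
    obtain ⟨l, hl⟩ := hv
    obtain ⟨m, hm⟩ := hw
    refine ⟨l ++ m, ?_⟩
    rw [seqValue_append, QuotientGroup.mk_mul, ← hl, ← hm, map_mul]
    rfl

/-- For an aspherical presentation, `Π̃` is generated by the elements `μσ(a a⁻¹)`. -/
theorem Aspherical.genIdentities_eq (hR : Aspherical R) : genIdentities R = pairSubgroup R := by
  refine le_antisymm (fun g hg => ?_) pairSubgroup_le_genIdentities
  obtain ⟨l, hl⟩ := exists_mk_seqValue g
  -- `g` and the value of `l` differ by an element of Ker θ̃, so `l` is an identity sequence.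
  have hθ : thetaTilde R (g⁻¹ * seqValue l) = 1 :=
    pairSubgroup_le_genIdentities (QuotientGroup.eq.1 hl)
  rw [map_mul, map_inv, show thetaTilde R g = 1 from hg, inv_one, one_mul,
    thetaTilde_seqValue] at hθ
  rw [mk_seqValue_eq_of_peifferEquiv (hR l hθ)] at hl
  exact (QuotientGroup.eq_one_iff g).1 hl

/-! ### Comparison of 𝒢(Υ₁) with 𝒢(Υ) -/

section Sub

variable (h : R₁ ⊆ R)

theorem fHat_mu_sigma (a : Letter R₁) :
    fHat h (mu R₁ (sigma a)) = mu R (sigma (a.incl h)) :=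
  EnvelopingGroup.lift_mu _ _

theorem fHat_pairIdentity (a : Letter R₁) :
    fHat h (a.pairIdentity : GUpsilon R₁) = (a.incl h).pairIdentity := by
  rw [Letter.coe_pairIdentity, Letter.coe_pairIdentity, map_mul, fHat_mu_sigma, fHat_mu_sigma]
  rfl

theorem thetaTilde_fHat (g : GUpsilon R₁) : thetaTilde R (fHat h g) = thetaTilde R₁ g := by
  have H : (thetaTilde R).comp (fHat h) = thetaTilde R₁ := by
    apply EnvelopingGroup.hom_ext
    intro a
    refine (congrArg (thetaTilde R) (fHat_mu_sigma h a)).trans ?_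
    exact (thetaTilde_mu_sigma _).trans (thetaTilde_mu_sigma a).symm
  exact DFunLike.congr_fun H g

theorem fHat_smul (w : FreeGroup X) (g : GUpsilon R₁) : fHat h (w • g) = w • fHat h g := by
  have H : (fHat h).comp (actHom R₁ w) = (actHom R w).comp (fHat h) := by
    apply EnvelopingGroup.hom_ext
    intro a
    refine (congrArg (fHat h) (actHom_mu_sigma w a)).trans ?_
    refine (fHat_mu_sigma h _).trans ?_
    refine Eq.trans ?_ (congrArg (actHom R w) (fHat_mu_sigma h a).symm)
    exact (actHom_mu_sigma w (a.incl h)).symm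
  exact DFunLike.congr_fun H g

theorem fHat_mem_genIdentities {d : GUpsilon R₁} (hd : d ∈ genIdentities R₁) :
    fHat h d ∈ genIdentities R :=
  (thetaTilde_fHat h d).trans hd

theorem pairIdentity_incl_mem_AHat (a : Letter R₁) :
    ((a.incl h).pairIdentity : GUpsilon R) ∈ AHat h :=
  Subgroup.subset_closure ⟨a, rfl⟩

/-- Allowing all `g`, not only identities, reduces the claim to generators, where the value is `1`
or a generator of 𝔄̂₁. -/
theorem pairHom_fHat_mem_AHat (g : GUpsilon R₁) :
    (pairHom R (fHat h g) : GUpsilon R) ∈ AHat h := by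
  obtain ⟨w, rfl⟩ := PresentedGroup.mk_surjective _ g
  have hof (a : Letter R₁) :
      (pairHom R (fHat h (PresentedGroup.of a : GUpsilon R₁)) : GUpsilon R) ∈ AHat h := by
    change (pairHom R (fHat h (mu R₁ (sigma a))) : GUpsilon R) ∈ AHat h
    rw [fHat_mu_sigma, pairHom_mu_sigma]
    split_ifs
    · exact pairIdentity_incl_mem_AHat h a
    · exact one_mem _
  let K : Subgroup (GUpsilon R₁) :=
    (AHat h).comap ((genIdentities R).subtype.comp ((pairHom R).comp (fHat h)))
  change PresentedGroup.mk _ w ∈ K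
  induction w using FreeGroup.induction_on with
  | C1 => exact K.one_mem
  | of a => exact hof a
  | inv_of a ha => exact K.inv_mem ha
  | mul v w hv hw => exact K.mul_mem hv hw

theorem Aspherical.map_fHat_genIdentities (hR : Aspherical R) :
    (genIdentities R₁).map (fHat h) = AHat h := by
  apply le_antisymm
  · rintro _ ⟨d, hd, rfl⟩
    have hm := fHat_mem_genIdentities h hd
    rw [hR.genIdentities_eq] at hm
    -- By asphericity `f̂(d)` is a product of pair elements and their inverses, hence fixed by the
    -- retraction.
    rw [← pairHom_of_mem_pairSubgroup hm]
    exact pairHom_fHat_mem_AHat h d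
  · rw [AHat, Subgroup.closure_le]
    rintro _ ⟨a, rfl⟩
    exact ⟨a.pairIdentity, a.pairIdentity.2, fHat_pairIdentity h a⟩

end Sub

/-! ### The displacement subgroup and the induced epimorphism -/

theorem mem_range_thetaTilde {r : FreeGroup X} (hr : r ∈ R) : r ∈ (thetaTilde R).range :=
  ⟨mu R (sigma ⟨1, ⟨r, hr⟩, 1⟩), by rw [thetaTilde_mu_sigma]; simp [Letter.theta]⟩

instance : (thetaTilde R).range.Normal where
  conj_mem := by
    rintro _ ⟨g, rfl⟩ w
    exact ⟨w • g, thetaTilde_smul w g⟩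

/-- By equivariance the action of `n` can be computed in Π̃, where every element of the image of θ̃
acts trivially. -/
theorem fHat_of_mem_displacement (h : R₁ ⊆ R) {N : Subgroup (FreeGroup X)}
    (hN : N ≤ (thetaTilde R).range) {d : genIdentities R₁} (hd : d ∈ displacement R₁ N) :
    fHat h (d : GUpsilon R₁) = 1 := by
  refine (Subgroup.closure_le ((fHat h).comp (genIdentities R₁).subtype).ker).2 ?_ hd
  rintro _ ⟨e, n, hn, rfl⟩
  obtain ⟨g, rfl⟩ := hN hn
  change fHat h ((e : GUpsilon R₁)⁻¹ * thetaTilde R g • (e : GUpsilon R₁)) = 1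
  rw [map_mul, map_inv, fHat_smul, thetaTilde_smul_of_mem (fHat_mem_genIdentities h e.2),
    inv_mul_cancel]

end GroupPresentation

open GroupPresentation in
theorem proposition5p2 {X : Type*} (R : Set (FreeGroup X)) (hR : Aspherical R)
    (r₀ : FreeGroup X) (hr₀ : r₀ ∈ R) :
    (genIdentities (R \ {r₀})).map (fHat (Set.sdiff_subset : R \ {r₀} ⊆ R)) =
        AHat (Set.sdiff_subset : R \ {r₀} ⊆ R) ∧
      ∃ φ : genIdentities (R \ {r₀}) ⧸ displacement (R \ {r₀}) (Subgroup.normalClosure {r₀}) →*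
          AHat (Set.sdiff_subset : R \ {r₀} ⊆ R),
        (∀ d : genIdentities (R \ {r₀}),
          (φ (QuotientGroup.mk d) : GUpsilon R) =
            fHat (Set.sdiff_subset : R \ {r₀} ⊆ R) (d : GUpsilon (R \ {r₀}))) ∧
        Function.Surjective φ := by
  have hmap := hR.map_fHat_genIdentities (Set.sdiff_subset : R \ {r₀} ⊆ R)
  -- The relator `r₀` is missing from 𝒫₁ but present in 𝒫, so N₀ lies in the image of θ̃.
  have hN : Subgroup.normalClosure {r₀} ≤ (thetaTilde R).range :=
    Subgroup.normalClosure_le_normal (Set.singleton_subset_iff.2 (mem_range_thetaTilde hr₀))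
  refine ⟨hmap, QuotientGroup.lift _
    (((fHat (Set.sdiff_subset : R \ {r₀} ⊆ R)).comp (genIdentities (R \ {r₀})).subtype).codRestrict
      (AHat (Set.sdiff_subset : R \ {r₀} ⊆ R))
      (fun d => hmap ▸ Subgroup.mem_map_of_mem _ d.2))
    (fun d hd => Subtype.ext (fHat_of_mem_displacement _ hN hd)), fun d => rfl, ?_⟩
  rintro ⟨x, hx⟩
  obtain ⟨d, hd, hdx⟩ := hmap.symm ▸ hx
  exact ⟨QuotientGroup.mk ⟨d, hd⟩, Subtype.ext hdx⟩
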